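/- For $\tau$ in the upper half-plane $\mathbb{H}=\{\tau\in\mathbb{C}:\operatorname{Im}\tau>0\}$ put $q=e^{2\pi i\tau}$ and $$E_2(\tau)=1-24\sum_{n=1}^\infty\frac{nq^n}{1-q^n},\quad E_4(\tau)=1+240\sum_{n=1}^\infty\frac{n^3q^n}{1-q^n},\quad E_6(\tau)=1-504\sum_{n=1}^\infty\frac{n^5q^n}{1-q^n},$$ $$\Delta=\tfrac{1}{1728}\left(E_4^3-E_6^2\right),$$ and write $DF=\frac{1}{2\pi i}\frac{dF}{d\tau}$ for a holomorphic function $F$ on $\mathbb{H}$. Then $E_2$, $E_4$, $E_6$ and $\Delta$ are holomorphic on $\mathbb{H}$, and the following identities hold on $\mathbb{H}$: $$DE_2=\tfrac{1}{12}\left(E_2^2-E_4\right),\qquad DE_4=\tfrac{1}{3}\left(E_2E_4-E_6\right),\qquad DE_6=\tfrac{1}{2}\left(E_2E_6-E_4^2\right).$$ Consequently, $D\Delta=E_2\Delta$. -/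

import Mathlib

open scoped Manifold

noncomputable section

namespace RamanujanIdentities

/-- The nome `q = exp (2 π i τ)`. -/
def nome (τ : UpperHalfPlane) : ℂ := Complex.exp (2 * Real.pi * Complex.I * τ)

/-- The Lambert series `∑_{n ≥ 1} n ^ k q ^ n / (1 - q ^ n)`, which converges absolutely for every
`τ` in the upper half-plane since there `0 < |q| < 1`. -/
def lambert (k : ℕ) (τ : UpperHalfPlane) : ℂ :=
  ∑' n : ℕ+, (n : ℂ) ^ k * nome τ ^ (n : ℕ) / (1 - nome τ ^ (n : ℕ))

/-- `E₂ = 1 - 24 ∑ n q ^ n / (1 - q ^ n)`. -/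
def E₂ (τ : UpperHalfPlane) : ℂ := 1 - 24 * lambert 1 τ

/-- `E₄ = 1 + 240 ∑ n ^ 3 q ^ n / (1 - q ^ n)`. -/
def E₄ (τ : UpperHalfPlane) : ℂ := 1 + 240 * lambert 3 τ

/-- `E₆ = 1 - 504 ∑ n ^ 5 q ^ n / (1 - q ^ n)`. -/
def E₆ (τ : UpperHalfPlane) : ℂ := 1 - 504 * lambert 5 τ

/-- `Δ = (E₄ ^ 3 - E₆ ^ 2) / 1728`. -/
def Δ (τ : UpperHalfPlane) : ℂ := (E₄ τ ^ 3 - E₆ τ ^ 2) / 1728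

/-- `D F = (2 π i)⁻¹ dF/dτ` for functions on the upper half-plane. -/
abbrev D (F : UpperHalfPlane → ℂ) : UpperHalfPlane → ℂ := Derivative.normalizedDerivOfComplex F

end RamanujanIdentities

end

open UpperHalfPlane hiding I
open Complex Filter Function Derivative
open scoped Real MatrixGroups Topology ModularForm Manifold ArithmeticFunction.sigma

/-! ### Behaviour at infinity from q-expansions -/

section qExpansion

variable {f : ℍ → ℂ} {c : ℕ → ℂ} {h : ℝ}

namespace QExpansion

/-! The defect of modularity of `E2` cancels in `D E2 - E2 ^ 2 / 12` and in the Serre derivative `D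
f - (k / 12) E2 f`, so these are invariant in weights 4 and `k + 2`. As `D = q d/dq` kills constant
terms and the Eisenstein series tend to 1, adding 1/12 of `E₄`, resp. `k / 12` of `E₆` or `E₄ ^ 2`,
gives a form vanishing at infinity. Its weight is below 12, where there are no nonzero cusp forms.
Divisor sums match the Lambert series with Mathlib's Eisenstein series, and the formula for `Δ`
follows by the Leibniz rule. -/

theorem periodic_comp_ofComplex_of_hasSum_qExpansion (hh : 0 < h)
    (hf : ∀ τ : ℍ, HasSum (fun m ↦ c m • Periodic.qParam h τ ^ m) (f τ)) :
    Periodic (f ∘ ofComplex) h := by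
  intro w
  by_cases! hw : 0 < im w
  · have hw' : 0 < im (w + h) := by simp [hw]
    simp only [comp_apply, ofComplex_apply_of_im_pos hw', ofComplex_apply_of_im_pos hw]
    refine (hf ⟨w + h, hw'⟩).unique ?_
    have := hf ⟨w, hw⟩
    rwa [show Periodic.qParam h (⟨w + h, hw'⟩ : ℍ) = Periodic.qParam h (⟨w, hw⟩ : ℍ) by
      have hh0 : (h : ℂ) ≠ 0 := mod_cast hh.ne'
      change cexp (2 * π * I * (w + h) / h) = cexp (2 * π * I * w / h)
      rw [mul_add, add_div, mul_div_cancel_right₀ _ hh0, Complex.exp_add, exp_two_pi_mul_I,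
        mul_one]]
  -- Off the half-plane `ofComplex` takes a constant default value.
  · have : im (w + h) ≤ 0 := by simpa using hw
    simp [ofComplex_apply_of_im_nonpos this, ofComplex_apply_of_im_nonpos hw]

theorem tendsto_atImInfty_of_hasSum_qExpansion (hh : 0 < h) (hfhol : MDiff f)
    (hf : ∀ τ : ℍ, HasSum (fun m ↦ c m • Periodic.qParam h τ ^ m) (f τ)) :
    Tendsto f atImInfty (𝓝 (c 0)) := by
  have hper := periodic_comp_ofComplex_of_hasSum_qExpansion hh hf
  have han := analyticAt_cuspFunction_zero hh hper hfhol
    (isBoundedAtImInfty_of_hasSum_qExpansion hh hf)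
  have h0 : c 0 = cuspFunction h f 0 := by
    simpa using (hasFPowerSeriesOnBall_cuspFunction hh han hf).coeff_zero 0
  rw [h0]
  refine (han.continuousAt.tendsto.comp (qParam_tendsto_atImInfty hh)).congr fun τ ↦ ?_
  exact eq_cuspFunction τ hh.ne' hper

/-- The normalized derivative is `q d/dq` in terms of the local parameter at infinity. -/
theorem normalizedDerivOfComplex_eq_qParam_mul_deriv_cuspFunction
    (hper : Periodic (f ∘ ofComplex) (1 : ℝ)) (hfhol : MDiff f) (hfbdd : IsBoundedAtImInfty f)
    (τ : ℍ) : normalizedDerivOfComplex f τ =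
      Periodic.qParam 1 τ * deriv (cuspFunction 1 f) (Periodic.qParam 1 τ) := by
  have hF := (differentiableAt_cuspFunction one_pos hper hfhol hfbdd
    (Periodic.norm_qParam_lt_one one_pos τ.im_pos)).hasDerivAt
  have hq : HasDerivAt (fun z : ℂ ↦ Periodic.qParam 1 z)
      (2 * π * I * Periodic.qParam 1 τ) (τ : ℂ) := by
    have h1 : HasDerivAt (fun z : ℂ ↦ 2 * π * I * z) (2 * π * I) (τ : ℂ) := by
      simpa using (hasDerivAt_id (τ : ℂ)).const_mul (2 * π * I)
    simpa only [Periodic.qParam, ofReal_one, div_one, mul_comm] using h1.cexp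
  have hcomp : f ∘ ofComplex =ᶠ[𝓝 (τ : ℂ)]
      cuspFunction 1 f ∘ fun z : ℂ ↦ Periodic.qParam 1 z := by
    filter_upwards [isOpen_upperHalfPlaneSet.mem_nhds τ.im_pos] with z hz
    have := eq_cuspFunction ⟨z, hz⟩ one_ne_zero hper
    simpa [ofComplex_apply_of_im_pos hz] using this.symm
  rw [normalizedDerivOfComplex, ((hF.comp (τ : ℂ) hq).congr_of_eventuallyEq hcomp).deriv]
  field_simp [Complex.two_pi_I_ne_zero]

theorem tendsto_normalizedDerivOfComplex_atImInfty
    (hper : Periodic (f ∘ ofComplex) (1 : ℝ)) (hfhol : MDiff f) (hfbdd : IsBoundedAtImInfty f) :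
    Tendsto (normalizedDerivOfComplex f) atImInfty (𝓝 0) := by
  have hq := qParam_tendsto_atImInfty one_pos
  have hd := (analyticAt_cuspFunction_zero one_pos hper hfhol hfbdd).deriv.continuousAt.tendsto
  have := hq.mul (hd.comp hq)
  rw [zero_mul] at this
  exact this.congr fun τ ↦
    (normalizedDerivOfComplex_eq_qParam_mul_deriv_cuspFunction hper hfhol hfbdd τ).symm

end QExpansion

end qExpansion

/-! ### Level one forms of small weight -/

section LevelOne

namespace ModularForm

/-- A holomorphic function of level one and weight less than twelve that vanishes at infinity is
zero. -/
theorem eq_zero_of_weight_lt_twelve_of_isZeroAtImInfty {k : ℤ} (hk : k < 12) {f : ℍ → ℂ}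
    (hf : MDiff f) (hinv : ∀ γ : SL(2, ℤ), f ∣[k] γ = f) (hzero : Tendsto f atImInfty (𝓝 0)) :
    f = 0 := by
  let g : CuspForm 𝒮ℒ k :=
    { toFun := f
      slash_action_eq' := fun _ ⟨γ, hγ⟩ ↦ hγ ▸ hinv γ
      holo' := hf
      zero_at_cusps' {c} hc := by
        -- `SL(2, ℤ)` carries infinity to every cusp, so invariance leaves only infinity to check.
        rw [OnePoint.isZeroAt_iff_forall_SL2Z hc]
        intro γ _
        rw [hinv γ]
        exact hzero }
  have hg : g = 0 :=
    rank_zero_iff_forall_zero.mp (CuspForm.rank_eq_zero_of_weight_lt_twelve hk) g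
  exact congrArg DFunLike.coe hg

theorem slash_eq {k : ℤ} (f : ModularForm 𝒮ℒ k) (γ : SL(2, ℤ)) : ⇑f ∣[k] γ = f :=
  SlashInvariantForm.slash_action_eqn f _ ⟨γ, rfl⟩

theorem levelOne_periodic_comp_ofComplex {k : ℤ} (f : ModularForm 𝒮ℒ k) :
    Periodic (f ∘ ofComplex) (1 : ℝ) :=
  SlashInvariantFormClass.periodic_comp_ofComplex f one_mem_strictPeriods_SL

theorem tendsto_E_atImInfty {k : ℕ} (hk : 3 ≤ k) (hk2 : Even k) :
    Tendsto (E hk) atImInfty (𝓝 1) := by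
  have := QExpansion.tendsto_atImInfty_of_hasSum_qExpansion one_pos (E hk).holo'
    fun τ ↦ ModularForm.hasSum_qExpansion (E hk) one_pos one_mem_strictPeriods_SL τ
  rwa [EisensteinSeries.E_qExpansion_coeff_zero hk hk2] at this

theorem tendsto_normalizedDerivOfComplex_levelOne {k : ℤ} (f : ModularForm 𝒮ℒ k) :
    Tendsto (normalizedDerivOfComplex f) atImInfty (𝓝 0) :=
  QExpansion.tendsto_normalizedDerivOfComplex_atImInfty (levelOne_periodic_comp_ofComplex f) f.holo'
    (ModularFormClass.bdd_at_infty f)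

end ModularForm

end LevelOne

/-! ### Ramanujan's identities for Eisenstein series -/

namespace EisensteinSeries

theorem hasSum_qParam_E2 (τ : ℍ) :
    HasSum (fun m : ℕ ↦ (if m = 0 then 1 else -24 * σ 1 m : ℂ) • Periodic.qParam 1 τ ^ m)
      (E2 τ) := by
  simpa only [Periodic.qParam, ofReal_one, div_one] using hasSum_qExpansion_E2 (z := τ)

theorem tendsto_E2_atImInfty : Tendsto E2 atImInfty (𝓝 1) :=
  QExpansion.tendsto_atImInfty_of_hasSum_qExpansion one_pos E2_mdifferentiable hasSum_qParam_E2

theorem tendsto_normalizedDerivOfComplex_E2 :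
    Tendsto (normalizedDerivOfComplex E2) atImInfty (𝓝 0) :=
  QExpansion.tendsto_normalizedDerivOfComplex_atImInfty
    (QExpansion.periodic_comp_ofComplex_of_hasSum_qExpansion one_pos hasSum_qParam_E2)
    E2_mdifferentiable isBoundedAtImInfty_E2

/-- `D2 γ` is, up to a scalar, the defect of `E2` under slashing by `γ`; its derivative enters the
transformation law of `D E2`. -/
theorem hasDerivAt_D2_comp_ofComplex (γ : SL(2, ℤ)) (τ : ℍ) :
    HasDerivAt (D2 γ ∘ ofComplex) (-(2 * π * I * γ 1 0 ^ 2 / denom γ τ ^ 2)) (τ : ℂ) := by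
  have h := (hasDerivAt_denom_zpow (γ : GL (Fin 2) ℝ) (-1) τ).const_mul (2 * π * I * γ 1 0)
  refine (h.congr_of_eventuallyEq ?_).congr_deriv ?_
  · filter_upwards [isOpen_upperHalfPlaneSet.mem_nhds τ.im_pos] with z hz
    simp [D2, ofComplex_apply_of_im_pos hz, div_eq_mul_inv]
  · have := denom_ne_zero (γ : GL (Fin 2) ℝ) τ
    simp [zpow_neg]
    field_simp

/-- `D E₂ - E₂ ^ 2 / 12` transforms like a modular form of weight four. -/
theorem normalizedDerivOfComplex_E2_sub_slash (γ : SL(2, ℤ)) :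
    (normalizedDerivOfComplex E2 - (12⁻¹ : ℂ) • (E2 * E2)) ∣[(4 : ℤ)] γ =
      normalizedDerivOfComplex E2 - (12⁻¹ : ℂ) • (E2 * E2) := by
  have hD2 : MDiff (D2 γ) := fun τ ↦
    UpperHalfPlane.mdifferentiableAt_iff.mpr (hasDerivAt_D2_comp_ofComplex γ τ).differentiableAt
  have hsl := E2_slash_action γ
  have hD := normalizedDerivOfComplex_SL_slash (k := 2) E2_mdifferentiable (γ := γ)
  have hmul := ModularForm.mul_slash_SL2 2 2 γ E2 E2
  rw [hsl] at hmul
  rw [hsl, normalizedDerivOfComplex_sub _ _ E2_mdifferentiable (hD2.const_smul _),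
    normalizedDerivOfComplex_smul _ _ hD2] at hD
  norm_num only at hD hmul
  ext τ
  have hDτ := congrFun hD τ
  have hmulτ := congrFun hmul τ
  have hd2 : normalizedDerivOfComplex (D2 γ) τ = -(γ 1 0 ^ 2 / denom γ τ ^ 2) := by
    rw [normalizedDerivOfComplex, (hasDerivAt_D2_comp_ofComplex γ τ).deriv]
    field_simp [Complex.two_pi_I_ne_zero]
  rw [sub_eq_add_neg, SlashAction.add_slash, SlashAction.neg_slash, ModularForm.SL_smul_slash]
  simp only [Pi.add_apply, Pi.neg_apply, Pi.sub_apply, Pi.smul_apply, Pi.mul_apply, smul_eq_mul,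
    hd2, D2, riemannZeta_two] at hDτ hmulτ ⊢
  rw [hmulτ]
  have hd := denom_ne_zero (γ : GL (Fin 2) ℝ) τ
  -- Solve for the slash of `D E2`, moving the term created by differentiating the automorphy
  -- factor.
  rw [eq_comm, sub_eq_iff_eq_add] at hDτ
  rw [hDτ]
  have hpi : (π : ℂ) ≠ 0 := by simp
  field_simp
  linear_combination (-72 * I * (γ 1 0 : ℂ) ^ 2 +
    24 * π * denom γ τ * γ 1 0 * E2 τ) * I_sq

theorem normalizedDerivOfComplex_E2 (τ : ℍ) :
    normalizedDerivOfComplex E2 τ = (1 / 12) * (E2 τ ^ 2 - ModularForm.E₄ τ) := by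
  have h := ModularForm.eq_zero_of_weight_lt_twelve_of_isZeroAtImInfty (k := 4) (by norm_num)
    (f := normalizedDerivOfComplex E2 - (12⁻¹ : ℂ) • (E2 * E2) + (12⁻¹ : ℂ) • ⇑ModularForm.E₄)
    (((normalizedDerivOfComplex_mdifferentiable E2_mdifferentiable).sub
      ((E2_mdifferentiable.mul E2_mdifferentiable).const_smul _)).add
        (ModularForm.E₄.holo'.const_smul _))
    (fun γ ↦ by
      rw [SlashAction.add_slash, normalizedDerivOfComplex_E2_sub_slash, ModularForm.SL_smul_slash,
        ModularForm.slash_eq])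
    (by
      have := (tendsto_normalizedDerivOfComplex_E2.sub ((tendsto_E2_atImInfty.mul
        tendsto_E2_atImInfty).const_smul (12⁻¹ : ℂ))).add
        ((ModularForm.tendsto_E_atImInfty (k := 4) (by norm_num) ⟨2, rfl⟩).const_smul (12⁻¹ : ℂ))
      convert this using 2 <;> simp)
  have hτ := congrFun h τ
  simp only [Pi.add_apply, Pi.sub_apply, Pi.smul_apply, Pi.mul_apply, smul_eq_mul,
    Pi.zero_apply] at hτ
  linear_combination hτ

/-- The Serre derivative of a modular form of level one and weight `k < 10` is determined by
its value at infinity. -/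
theorem serreDerivative_eq_of_tendsto {k l : ℤ} (hl : k + 2 = l) (hk : l < 12)
    (f : ModularForm 𝒮ℒ k) (g : ModularForm 𝒮ℒ l) (hf : Tendsto f atImInfty (𝓝 1))
    (hg : Tendsto g atImInfty (𝓝 1)) (τ : ℍ) :
    normalizedDerivOfComplex f τ = k / 12 * (E2 τ * f τ - g τ) := by
  subst hl
  have h := ModularForm.eq_zero_of_weight_lt_twelve_of_isZeroAtImInfty hk
    (f := serreDerivative k f + (k / 12 : ℂ) • ⇑g)
    ((serreDerivative_mdifferentiable _ f.holo').add (g.holo'.const_smul _))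
    (fun γ ↦ by
      rw [SlashAction.add_slash, serreDerivative_slash_invariant (F := f) f.holo' (f.slash_eq γ),
        ModularForm.SL_smul_slash, ModularForm.slash_eq])
    (by
      have := (f.tendsto_normalizedDerivOfComplex_levelOne.sub
        ((tendsto_E2_atImInfty.const_mul (k * 12⁻¹ : ℂ)).mul hf)).add
        (hg.const_smul (k / 12 : ℂ))
      convert this using 2 <;> simp [div_eq_mul_inv])
  have hτ := congrFun h τ
  simp only [Pi.add_apply, serreDerivative_apply, Pi.smul_apply, smul_eq_mul,
    Pi.zero_apply] at hτ
  linear_combination hτ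

theorem normalizedDerivOfComplex_E₄ (τ : ℍ) :
    normalizedDerivOfComplex ModularForm.E₄ τ =
      (1 / 3) * (E2 τ * ModularForm.E₄ τ - ModularForm.E₆ τ) := by
  rw [serreDerivative_eq_of_tendsto (by norm_num) (by norm_num) ModularForm.E₄ ModularForm.E₆
    (ModularForm.tendsto_E_atImInfty (k := 4) (by norm_num) ⟨2, rfl⟩)
    (ModularForm.tendsto_E_atImInfty (k := 6) (by norm_num) ⟨3, rfl⟩)]
  norm_num

theorem normalizedDerivOfComplex_E₆ (τ : ℍ) :
    normalizedDerivOfComplex ModularForm.E₆ τ =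
      (1 / 2) * (E2 τ * ModularForm.E₆ τ - ModularForm.E₄ τ ^ 2) := by
  have h4 := ModularForm.tendsto_E_atImInfty (k := 4) (by norm_num) ⟨2, rfl⟩
  rw [serreDerivative_eq_of_tendsto (by norm_num) (by norm_num) ModularForm.E₆
    -- `E₄ ^ 2` serves as the weight 8 form with value 1 at infinity.
    (ModularForm.E₄.mul ModularForm.E₄)
    (ModularForm.tendsto_E_atImInfty (k := 6) (by norm_num) ⟨3, rfl⟩)
    (by rw [ModularForm.coe_mul]; simpa using! h4.mul h4)]
  rw [ModularForm.coe_mul, Pi.mul_apply, ← pow_two]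
  norm_num

end EisensteinSeries

/-! ### Transfer to the Lambert series -/

namespace RamanujanIdentities

theorem lambert_eq_tsum_sigma (k : ℕ) (τ : ℍ) :
    lambert k τ = ∑' n : ℕ+, (σ k n : ℂ) * cexp (2 * π * I * τ) ^ (n : ℕ) :=
  tsum_pow_div_one_sub_eq_tsum_sigma (norm_exp_two_pi_I_lt_one τ) k

theorem E₂_eq : E₂ = EisensteinSeries.E2 := by
  ext τ
  rw [EisensteinSeries.E2_eq_tsum_cexp, E₂, lambert_eq_tsum_sigma]

theorem E₄_eq : E₄ = ModularForm.E₄ := by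
  ext τ
  -- The coefficient is `-2k / B_k` with `k = 4`, that is 240.
  rw [EisensteinSeries.q_expansion_bernoulli _ ⟨2, rfl⟩, E₄, lambert_eq_tsum_sigma,
    show bernoulli 4 = -1 / 30 by decide +kernel]
  norm_num

theorem E₆_eq : E₆ = ModularForm.E₆ := by
  ext τ
  rw [EisensteinSeries.q_expansion_bernoulli _ ⟨3, rfl⟩, E₆, lambert_eq_tsum_sigma,
    show bernoulli 6 = 1 / 42 by decide +kernel]
  norm_num

theorem Δ_eq : Δ = (1728⁻¹ : ℂ) • (E₄ ^ 3 - E₆ ^ 2) := by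
  ext τ
  simp [Δ, div_eq_inv_mul]

theorem mdifferentiable_E₂ : MDiff E₂ := E₂_eq ▸ E2_mdifferentiable

theorem mdifferentiable_E₄ : MDiff E₄ := E₄_eq ▸ ModularForm.E₄.holo'

theorem mdifferentiable_E₆ : MDiff E₆ := E₆_eq ▸ ModularForm.E₆.holo'

theorem mdifferentiable_Δ : MDiff Δ :=
  Δ_eq ▸ ((mdifferentiable_E₄.pow 3).sub (mdifferentiable_E₆.pow 2)).const_smul _

theorem D_E₂ (τ : ℍ) : D E₂ τ = (1 / 12) * (E₂ τ ^ 2 - E₄ τ) := by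
  simpa only [E₂_eq, E₄_eq] using EisensteinSeries.normalizedDerivOfComplex_E2 τ

theorem D_E₄ (τ : ℍ) : D E₄ τ = (1 / 3) * (E₂ τ * E₄ τ - E₆ τ) := by
  simpa only [E₂_eq, E₄_eq, E₆_eq] using EisensteinSeries.normalizedDerivOfComplex_E₄ τ

theorem D_E₆ (τ : ℍ) : D E₆ τ = (1 / 2) * (E₂ τ * E₆ τ - E₄ τ ^ 2) := by
  simpa only [E₂_eq, E₄_eq, E₆_eq] using EisensteinSeries.normalizedDerivOfComplex_E₆ τ

theorem D_Δ (τ : ℍ) : D Δ τ = E₂ τ * Δ τ := by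
  have h4 := mdifferentiable_E₄
  have h6 := mdifferentiable_E₆
  rw [Δ_eq, normalizedDerivOfComplex_smul _ _ ((h4.pow 3).sub (h6.pow 2)),
    normalizedDerivOfComplex_sub _ _ (h4.pow 3) (h6.pow 2),
    normalizedDerivOfComplex_pow _ _ h4, normalizedDerivOfComplex_pow _ _ h6]
  simp only [Pi.smul_apply, Pi.sub_apply, Pi.mul_apply, Pi.pow_apply, smul_eq_mul,
    Pi.natCast_apply, D_E₄ τ, D_E₆ τ]
  push_cast
  -- The two `E₄ ^ 2 * E₆` terms cancel.
  ring

end RamanujanIdentities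

theorem proposition7 :
    (MDifferentiable 𝓘(ℂ) 𝓘(ℂ) RamanujanIdentities.E₂ ∧
      MDifferentiable 𝓘(ℂ) 𝓘(ℂ) RamanujanIdentities.E₄ ∧
      MDifferentiable 𝓘(ℂ) 𝓘(ℂ) RamanujanIdentities.E₆ ∧
      MDifferentiable 𝓘(ℂ) 𝓘(ℂ) RamanujanIdentities.Δ) ∧
    (∀ τ : UpperHalfPlane, RamanujanIdentities.D RamanujanIdentities.E₂ τ =
      (1 / 12) * (RamanujanIdentities.E₂ τ ^ 2 - RamanujanIdentities.E₄ τ)) ∧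
    (∀ τ : UpperHalfPlane, RamanujanIdentities.D RamanujanIdentities.E₄ τ =
      (1 / 3) * (RamanujanIdentities.E₂ τ * RamanujanIdentities.E₄ τ
        - RamanujanIdentities.E₆ τ)) ∧
    (∀ τ : UpperHalfPlane, RamanujanIdentities.D RamanujanIdentities.E₆ τ =
      (1 / 2) * (RamanujanIdentities.E₂ τ * RamanujanIdentities.E₆ τ
        - RamanujanIdentities.E₄ τ ^ 2)) ∧
    (∀ τ : UpperHalfPlane, RamanujanIdentities.D RamanujanIdentities.Δ τ =
      RamanujanIdentities.E₂ τ * RamanujanIdentities.Δ τ) :=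
  ⟨⟨RamanujanIdentities.mdifferentiable_E₂, RamanujanIdentities.mdifferentiable_E₄,
    RamanujanIdentities.mdifferentiable_E₆, RamanujanIdentities.mdifferentiable_Δ⟩,
    RamanujanIdentities.D_E₂, RamanujanIdentities.D_E₄, RamanujanIdentities.D_E₆,
    RamanujanIdentities.D_Δ⟩
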